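/- Let $\mathbb K=\mathbb R$ or $\mathbb C$, let $n\ge 1$, and let $f:\mathbb K^n\to\mathbb K$ be a polynomial function of positive degree $d$, with leading form $f_d$ (its homogeneous part of degree $d$). Assume that $f_d$ is generic, in the sense that it is irreducible in $\mathbb K[x_1,\dots,x_n]$ and every critical point of $f_d$ at which $f_d$ vanishes is the origin: $f_d^{-1}(0)\cap\operatorname{crit}(f_d)\subset\{0\}$. Let $c\in\mathbb K$ be such that the level $f^{-1}(c)$ is non-empty and regular, that is, contains no critical point of $f$. Then $f^{-1}(c)$ is conic at infinity, and each of its connected components is Lipschitz normally embedded (LNE). If $\mathbb K=\mathbb C$, then for every $c\in\mathbb C$ the level $f^{-1}(c)$ is an irreducible algebraic set: it is non-empty and is not the union of two proper algebraic subsets. Here $\mathbb K^n$ is regarded as the Euclidean space $\mathbb R^N$, with $N=n$ or $N=2n$. A subset $S$ is LNE if there is a constant $L>0$ such that any $x,y\in S$ satisfy $d_{\rm inn}^S(x,y)\le L|x-y|$, where $d_{\rm inn}^S(x,y)\in[0,\infty]$ is the infimum of the lengths of the rectifiable paths in $S$ joining $x$ and $y$. Compactify $\mathbb R^N$ by a sphere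 at infinity, using the chart $M=[0,\infty)\times\mathbb S^{N-1}$ in which $(r,u)$ with $r>0$ represents the point $u/r$, and in which $\partial M=\{0\}\times\mathbb S^{N-1}$ is the sphere at infinity. A subset $X$ of $\mathbb R^N$ is conic at infinity if it is bounded, or if its closure $\overline X$ in this compactification meets $\partial M$ and is, near each point of $\overline X\cap\partial M$, a smooth p-sub-manifold of $M$: a smooth sub-manifold $N_0$ with boundary $\partial N_0=N_0\cap\partial M$, such that $T_pN_0+T_p\partial M=T_pM$ for every $p\in\partial N_0$. -/

import Mathlib

open scoped ContDiff

noncomputable section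

namespace ConicLNE

/-! ### Inner distance and Lipschitz normal embedding -/

section Metric

variable {E : Type*} [NormedAddCommGroup E]

/-- The inner distance of `S`: the infimum of the lengths of the paths lying in `S` that join
`x` to `y`. It is `∞` if no rectifiable path in `S` joins the two points. -/
def innerDist (S : Set E) (x y : E) : ENNReal :=
  ⨅ (γ : Path x y) (_ : ∀ t, γ t ∈ S), eVariationOn γ Set.univ

/-- `S` is Lipschitz normally embedded: the inner distance is bounded by a constant times the
outer distance. -/
def IsLNE (S : Set E) : Prop :=
  ∃ L : ℝ, 0 < L ∧ ∀ x ∈ S, ∀ y ∈ S, innerDist S x y ≤ ENNReal.ofReal L * edist x y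

end Metric

/-! ### Sub-manifolds with boundary and p-sub-manifolds -/

section Submanifold

/-- `Φ` is a smooth chart of the vector space `F`, centred at `p`, which exhibits `N` near `p` as
a smooth sub-manifold with boundary, with `p` on the boundary: within the domain of `Φ`, the set
`N` is the preimage of the half-space `{0 ≤ ℓ}` of the linear subspace `V`
(and `∂N` is the preimage of `V ∩ {ℓ = 0}`). -/
structure IsBoundaryChart {F : Type*} [NormedAddCommGroup F] [NormedSpace ℝ F]
    (N : Set F) (p : F) (Φ : OpenPartialHomeomorph F F) (V : Submodule ℝ F)
    (ℓ : F →L[ℝ] ℝ) : Prop where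
  mem_source : p ∈ Φ.source
  map_center : Φ p = 0
  smooth : ContDiffOn ℝ ∞ Φ Φ.source
  smooth_symm : ContDiffOn ℝ ∞ Φ.symm Φ.target
  nontrivial : ∃ v ∈ V, ℓ v ≠ 0
  mem_iff : ∀ x ∈ Φ.source, (x ∈ N ↔ Φ x ∈ V ∧ 0 ≤ ℓ (Φ x))

variable {E : Type*} [NormedAddCommGroup E] [NormedSpace ℝ E]

/-- The tangent space at `u` of the unit sphere of `E` (where `E` carries a Euclidean norm), that
is, the kernel of the derivative of `‖·‖ ^ 2` at `u`. -/
def sphereTangent (u : E) : Submodule ℝ E :=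
  LinearMap.ker (fderiv ℝ (fun v : E => ‖v‖ ^ 2) u).toLinearMap

/-- For a subset `N` of the manifold with boundary `M = [0, ∞) × 𝕊`, where `𝕊` is the unit sphere
of `E` and `∂M = {0} × 𝕊`: the germ of `N` at the point `(0, u)` of `N ∩ ∂M` is that of a smooth
p-sub-manifold of `M`. That is, near `(0, u)`, `N` is a smooth sub-manifold with boundary, its
boundary is `N ∩ ∂M`, and at `p = (0, u)` it is transverse to `∂M`: `T_p N + T_p ∂M = T_p M`. -/
def IsPSubmanifoldAt (N : Set (ℝ × E)) (u : E) : Prop :=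
  ∃ (Φ : OpenPartialHomeomorph (ℝ × E) (ℝ × E)) (V : Submodule ℝ (ℝ × E))
    (ℓ : (ℝ × E) →L[ℝ] ℝ),
    IsBoundaryChart N (0, u) Φ V ℓ ∧
    (∀ x ∈ Φ.source, x ∈ N → (ℓ (Φ x) = 0 ↔ x.1 = 0)) ∧
    V.comap (fderiv ℝ Φ (0, u)).toLinearMap ⊔ (⊥ : Submodule ℝ ℝ).prod (sphereTangent u)
      = (⊤ : Submodule ℝ ℝ).prod (sphereTangent u)

/-! ### The sphere at infinity -/

/-- The closure of `X` in the spherical compactification of `E`, read in the chart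
`[0, ∞) × 𝕊` at infinity, in which `(r, u)` with `0 < r` is the point `u / r` of `E` and
`{0} × 𝕊` is the sphere at infinity. -/
def closureAtInfinity (X : Set E) : Set (ℝ × E) :=
  closure {q : ℝ × E | 0 < q.1 ∧ ‖q.2‖ = 1 ∧ q.1⁻¹ • q.2 ∈ X}

/-- The asymptotic set of `X` at infinity, a subset of the unit sphere. -/
def asymptoticSet (X : Set E) : Set E :=
  {u | ((0 : ℝ), u) ∈ closureAtInfinity X}

/-- `X` is conic at infinity: it is bounded, or its closure is, near the (non-empty) asymptotic
set, a smooth p-sub-manifold of the spherical compactification. -/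
def IsConicAtInfinity (X : Set E) : Prop :=
  Bornology.IsBounded X ∨
    ((asymptoticSet X).Nonempty ∧
      ∀ u ∈ asymptoticSet X, IsPSubmanifoldAt (closureAtInfinity X) u)

end Submanifold

/-! ### Polynomials and algebraic sets -/

section Polynomials

variable {𝕜 : Type*} [RCLike 𝕜] {n : ℕ}

/-- The leading form of `f`: its homogeneous component of highest degree. -/
def leadingForm (f : MvPolynomial (Fin n) 𝕜) : MvPolynomial (Fin n) 𝕜 :=
  MvPolynomial.homogeneousComponent f.totalDegree f

/-- The level `f⁻¹(c)` in `𝕜ⁿ` with its Euclidean metric. -/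
def level (f : MvPolynomial (Fin n) 𝕜) (c : 𝕜) : Set (EuclideanSpace 𝕜 (Fin n)) :=
  {x | MvPolynomial.eval (fun i => x i) f = c}

/-- The critical locus of `f`. -/
def critLocus (f : MvPolynomial (Fin n) 𝕜) : Set (EuclideanSpace 𝕜 (Fin n)) :=
  {x | ∀ i, MvPolynomial.eval (fun j => x j) (MvPolynomial.pderiv i f) = 0}

/-- The form `g` is generic: irreducible, and its only possible critical zero is the origin. -/
def IsGenericForm (g : MvPolynomial (Fin n) 𝕜) : Prop :=
  Irreducible g ∧ level g 0 ∩ critLocus g ⊆ {0}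

/-- `Z` is the common zero set in `𝕜ⁿ` of a set of polynomials. -/
def IsAlgebraicSet (Z : Set (EuclideanSpace 𝕜 (Fin n))) : Prop :=
  ∃ S : Set (MvPolynomial (Fin n) 𝕜),
    Z = {x | ∀ p ∈ S, MvPolynomial.eval (fun i => x i) p = 0}

/-- `Z` is an irreducible algebraic set: non-empty, and not the union of two proper algebraic
subsets. -/
def IsIrreducibleAlgebraicSet (Z : Set (EuclideanSpace 𝕜 (Fin n))) : Prop :=
  IsAlgebraicSet Z ∧ Z.Nonempty ∧
    ∀ Z₁ Z₂ : Set (EuclideanSpace 𝕜 (Fin n)), IsAlgebraicSet Z₁ → IsAlgebraicSet Z₂ →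
      Z = Z₁ ∪ Z₂ → Z = Z₁ ∨ Z = Z₂

end Polynomials

end ConicLNE

end

/-! The level `f = 0` is the affine part of the projective zero set of the homogenization `H` of
`f`, a map on `ℝ × 𝕜ⁿ` whose restriction to the hyperplane `{r = 0}` at infinity is the leading
form. Points of the level and its points at infinity thus become the points of a compact
hemisphere where `H` vanishes, and regularity of the level, respectively of the leading form, says
that `H` is a submersion there along the slices `r = const`.

Near such a point a chart preserving `r` makes the zero set of `H` linear. Extended homogeneously
from the slice `r = 1` to the cone over it, it is still Lipschitz, so it carries the level near the
point to a convex set, on which segments are short; this bounds the inner distance locally,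
uniformly out to infinity. Compactness of the hemisphere turns the local bounds into a global one:
near the diagonal they apply as they are, and off the diagonal `|x - y|` is comparable to
`1 + |x| + |y|`, which bounds the inner distance up to a constant. At infinity the same charts,
for `H` together with the equation of the sphere, exhibit the closure of the level as a
p-sub-manifold.

Leading forms are multiplicative, so `f - c` is irreducible when its leading form is, and over an
algebraically closed field the Nullstellensatz makes its zero set irreducible. -/

namespace ConicLNE

open Set Filter Topology Metric
open scoped NNReal

section InnerDistance

variable {E : Type*} [NormedAddCommGroup E]

theorem innerDist_le_mul_eVariationOn {F : Type*} [PseudoEMetricSpace F] {Ω : Set F} {S : Set E}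
    {f : F → E} {K : ℝ≥0} (hf : LipschitzOnWith K f Ω) (hmaps : MapsTo f Ω S) {p q : F}
    (γ : Path p q) (hγ : ∀ t, γ t ∈ Ω) :
    innerDist S (f p) (f q) ≤ K * eVariationOn γ univ :=
  (iInf₂_le (γ.map' (hf.continuousOn.mono (range_subset_iff.2 hγ))) fun t => hmaps (hγ t)).trans
    (hf.comp_eVariationOn_le fun t _ => hγ t)

theorem eVariationOn_segment_le {F : Type*} [NormedAddCommGroup F] [NormedSpace ℝ F] (p q : F) :
    eVariationOn (Path.segment p q) univ ≤ edist p q := by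
  have hcoe : eVariationOn ((↑) : unitInterval → ℝ) univ ≤ 1 := by
    have hmono : MonotoneOn ((↑) : unitInterval → ℝ) univ := fun _ _ _ _ h => h
    simpa [← unitInterval.univ_eq_Icc] using (hmono.eVariationOn_eq (mem_univ 0) (mem_univ 1)).le
  have hlip : LipschitzWith (nndist p q) (AffineMap.lineMap p q : ℝ → F) :=
    lipschitzWith_lineMap p q
  calc eVariationOn (Path.segment p q) univ
      ≤ nndist p q * eVariationOn ((↑) : unitInterval → ℝ) univ :=
        (hlip.lipschitzOnWith (s := univ)).comp_eVariationOn_le (mapsTo_univ _ _)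
    _ ≤ nndist p q * 1 := by gcongr
    _ = edist p q := by rw [mul_one, edist_nndist]

theorem innerDist_le_of_lipschitzOnWith_convex {F : Type*} [NormedAddCommGroup F]
    [NormedSpace ℝ F] {Ω : Set F} (hΩ : Convex ℝ Ω) {S : Set E} {f : F → E} {K : ℝ≥0}
    (hf : LipschitzOnWith K f Ω) (hmaps : MapsTo f Ω S) {p q : F} (hp : p ∈ Ω) (hq : q ∈ Ω) :
    innerDist S (f p) (f q) ≤ K * edist p q := by
  have hseg : ∀ t, Path.segment p q t ∈ Ω := range_subset_iff.1 <| by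
    rw [Path.range_segment]
    exact hΩ.segment_subset hp hq
  exact (innerDist_le_mul_eVariationOn hf hmaps _ hseg).trans
    (mul_le_mul_right (eVariationOn_segment_le p q) _)

theorem innerDist_comm (S : Set E) (x y : E) : innerDist S x y = innerDist S y x := by
  have le_swap : ∀ x y : E, innerDist S x y ≤ innerDist S y x := fun x y =>
    le_iInf₂ fun γ hγ => (iInf₂_le γ.symm fun t => hγ _).trans <|
      eVariationOn.comp_le_of_antitoneOn γ unitInterval.symm
        (fun _ _ _ _ h => unitInterval.symm_le_symm.2 h) (mapsTo_univ _ _)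
  exact le_antisymm (le_swap x y) (le_swap y x)

theorem eVariationOn_trans_le {x y z : E} (γ : Path x y) (γ' : Path y z) :
    eVariationOn (γ.trans γ') univ ≤ eVariationOn γ univ + eVariationOn γ' univ := by
  let half : unitInterval := ⟨1 / 2, by norm_num, by norm_num⟩
  have first_half : EqOn (γ.trans γ')
      (γ ∘ fun t => projIcc (0 : ℝ) 1 zero_le_one (2 * t)) (Iic half) := by
    intro t ht
    have ht' : (t : ℝ) ≤ 1 / 2 := ht
    rw [Path.trans_apply, dif_pos ht', Function.comp_apply, projIcc_of_mem]
  have second_half : EqOn (γ.trans γ')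
      (γ' ∘ fun t => projIcc (0 : ℝ) 1 zero_le_one (2 * t - 1)) (Ici half) := by
    intro t ht
    have ht' : 1 / 2 ≤ (t : ℝ) := ht
    rcases ht'.eq_or_lt with h | h
    · obtain rfl : t = half := Subtype.ext h.symm
      simp [Path.trans_apply, half]
    · rw [Path.trans_apply, dif_neg h.not_ge, Function.comp_apply, projIcc_of_mem]
  rw [← Iic_union_Ici (a := half),
    eVariationOn.union _ isGreatest_Iic isLeast_Ici,
    eVariationOn.congr first_half, eVariationOn.congr second_half, Iic_union_Ici]
  refine add_le_add
    (eVariationOn.comp_le_of_monotoneOn γ _ (fun a _ b _ hab => monotone_projIcc _ ?_)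
      (mapsTo_univ _ _))
    (eVariationOn.comp_le_of_monotoneOn γ' _ (fun a _ b _ hab => monotone_projIcc _ ?_)
      (mapsTo_univ _ _)) <;>
  · have : (a : ℝ) ≤ b := hab
    linarith

theorem innerDist_triangle (S : Set E) (x y z : E) :
    innerDist S x z ≤ innerDist S x y + innerDist S y z := by
  simp only [innerDist, ENNReal.iInf_add, ENNReal.add_iInf]
  refine le_iInf₂ fun γ' hγ' => le_iInf₂ fun γ hγ =>
    (iInf₂_le (γ.trans γ') fun t => ?_).trans (eVariationOn_trans_le γ γ')
  rw [Path.trans_apply]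
  split_ifs
  exacts [hγ _, hγ' _]

theorem innerDist_connectedComponentIn_le {X : Set E} {x₀ x : E}
    (hx : x ∈ connectedComponentIn X x₀) (y : E) :
    innerDist (connectedComponentIn X x₀) x y ≤ innerDist X x y := by
  refine le_iInf₂ fun γ hγ => iInf₂_le γ fun t => ?_
  rw [connectedComponentIn_eq hx]
  exact (isPreconnected_range γ.continuous).subset_connectedComponentIn ⟨0, γ.source⟩
    (range_subset_iff.2 hγ) ⟨t, rfl⟩

end InnerDistance

theorem exists_forall_of_eventually_comap {A Z ι : Type*} [TopologicalSpace Z]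
    [SemilatticeSup ι] [Nonempty ι] {K : Set Z} (hK : IsCompact K) {κ : A → Z}
    (hκ : ∀ a, κ a ∈ K) {P : ι → A → Prop} (hP : ∀ a, Monotone fun i => P i a)
    (hloc : ∀ z ∈ K, ∃ i, ∀ᶠ a in comap κ (𝓝 z), P i a) :
    ∃ i, ∀ a, P i a := by
  suffices ∃ i, ∀ a, κ a ∈ K → P i a from this.imp fun _ h a => h a (hκ a)
  refine hK.induction_on (p := fun S => ∃ i, ∀ a, κ a ∈ S → P i a)
    ⟨Classical.arbitrary ι, fun _ => False.elim⟩ ?_ ?_ fun z hz => ?_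
  · rintro S T hST ⟨i, h⟩
    exact ⟨i, fun a ha => h a (hST ha)⟩
  · rintro S T ⟨i, hi⟩ ⟨j, hj⟩
    exact ⟨i ⊔ j, fun a ha => ha.elim (fun h => hP a le_sup_left (hi a h))
      fun h => hP a le_sup_right (hj a h)⟩
  · obtain ⟨i, hi⟩ := hloc z hz
    obtain ⟨S, hS, h⟩ := mem_comap.1 hi
    exact ⟨S, mem_nhdsWithin_of_mem_nhds hS, i, h⟩

section Perspective

variable {E Y : Type*} [NormedAddCommGroup E] [NormedSpace ℝ E]
  [NormedAddCommGroup Y] [NormedSpace ℝ Y]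

/-- The projective involution `(s, w) ↦ (1 / s, w / s)` of the half-space `{0 < s}`. It exchanges
the points at infinity with the points of the hyperplane `{s = 0}`. -/
noncomputable def perspective (p : ℝ × E) : ℝ × E := p.1⁻¹ • (1, p.2)

@[simp]
theorem perspective_fst (p : ℝ × E) : (perspective p).1 = p.1⁻¹ := by simp [perspective]

theorem fst_smul_perspective {p : ℝ × E} (hp : p.1 ≠ 0) :
    p.1 • perspective p = (1, p.2) :=
  smul_inv_smul₀ hp _

theorem mul_dist_perspective_le {p q : ℝ × E} (hp : p.1 ≠ 0) (hq : 0 < q.1) :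
    q.1 * dist (perspective p) (perspective q)
      ≤ ‖perspective p‖ * dist p.1 q.1 + dist p.2 q.2 := by
  have hsplit : q.1 • (perspective p - perspective q)
      = (q.1 - p.1) • perspective p + ((0 : ℝ), p.2 - q.2) := by
    rw [smul_sub, sub_smul, fst_smul_perspective hp, fst_smul_perspective hq.ne']
    ext <;> simp
  calc q.1 * dist (perspective p) (perspective q)
      = ‖q.1 • (perspective p - perspective q)‖ := by
        rw [norm_smul, Real.norm_of_nonneg hq.le, dist_eq_norm]
    _ ≤ ‖(q.1 - p.1) • perspective p‖ + ‖((0 : ℝ), p.2 - q.2)‖ := by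
        rw [hsplit]
        exact norm_add_le _ _
    _ = ‖perspective p‖ * dist p.1 q.1 + dist p.2 q.2 := by
        rw [norm_smul, dist_comm, dist_eq_norm, dist_eq_norm, mul_comm]
        simp [Prod.norm_def]

theorem convex_perspective_preimage {Q : Set (ℝ × E)} (hQ : Convex ℝ Q) :
    Convex ℝ {p : ℝ × E | 0 < p.1 ∧ perspective p ∈ Q} := by
  rintro p ⟨hp, hpQ⟩ q ⟨hq, hqQ⟩ a b ha hb hab
  have hs : 0 < a * p.1 + b * q.1 := (convex_Ioi (0 : ℝ)) hp hq ha hb hab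
  refine ⟨hs, ?_⟩
  have hcomb : perspective (a • p + b • q)
      = (a * p.1 / (a * p.1 + b * q.1)) • perspective p
        + (b * q.1 / (a * p.1 + b * q.1)) • perspective q := by
    simp only [div_eq_inv_mul, mul_smul, ← smul_add, fst_smul_perspective hp.ne',
      fst_smul_perspective hq.ne']
    simp [perspective, hab]
  rw [hcomb]
  exact hQ hpQ hqQ (by positivity) (by positivity) (by rw [← add_div, div_self hs.ne'])

/-- The extension of `φ` from the hyperplane at height one to the cone over it, read through the
projective involution. -/
noncomputable def coneExtension (φ : ℝ × E → Y) (p : ℝ × E) : Y := p.1 • φ (perspective p)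

theorem isBounded_image_of_lipschitzOnWith {A B : Type*} [PseudoMetricSpace A]
    [PseudoMetricSpace B] {φ : A → B} {Q : Set A} {K : ℝ≥0} (hφ : LipschitzOnWith K φ Q)
    (hQ : Bornology.IsBounded Q) : Bornology.IsBounded (φ '' Q) := by
  obtain ⟨C, hC⟩ := isBounded_iff.1 hQ
  refine isBounded_iff.2 ⟨K * C, ?_⟩
  rintro _ ⟨p, hp, rfl⟩ _ ⟨q, hq, rfl⟩
  exact (hφ.dist_le_mul p hp q hq).trans (mul_le_mul_of_nonneg_left (hC hp hq) K.2)

theorem exists_lipschitzOnWith_coneExtension {φ : ℝ × E → Y} {Q : Set (ℝ × E)} {K : ℝ≥0}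
    (hφ : LipschitzOnWith K φ Q) (hQ : Bornology.IsBounded Q) :
    ∃ K' : ℝ≥0,
      LipschitzOnWith K' (coneExtension φ) {p : ℝ × E | 0 < p.1 ∧ perspective p ∈ Q} := by
  obtain ⟨B, hB⟩ := hQ.exists_norm_le
  obtain ⟨B', hB'⟩ := (isBounded_image_of_lipschitzOnWith hφ hQ).exists_norm_le
  refine ⟨(B' + K * (B + 1)).toNNReal, LipschitzOnWith.of_dist_le_mul ?_⟩
  rintro p ⟨hp, hpQ⟩ q ⟨hq, hqQ⟩
  have hsplit : coneExtension φ p - coneExtension φ q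
      = (p.1 - q.1) • φ (perspective p) + q.1 • (φ (perspective p) - φ (perspective q)) := by
    simp only [coneExtension]
    module
  have hfst : dist p.1 q.1 ≤ dist p q := le_max_left _ _
  have hsnd : dist p.2 q.2 ≤ dist p q := le_max_right _ _
  calc dist (coneExtension φ p) (coneExtension φ q)
      ≤ dist p.1 q.1 * ‖φ (perspective p)‖
        + q.1 * dist (φ (perspective p)) (φ (perspective q)) := by
        rw [dist_eq_norm, hsplit]
        refine (norm_add_le _ _).trans_eq ?_
        rw [norm_smul, norm_smul, Real.norm_of_nonneg hq.le, dist_eq_norm, dist_eq_norm]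
    _ ≤ dist p.1 q.1 * ‖φ (perspective p)‖
        + K * (q.1 * dist (perspective p) (perspective q)) := by
        rw [mul_left_comm]
        gcongr
        exact hφ.dist_le_mul _ hpQ _ hqQ
    _ ≤ dist p q * B' + K * (B * dist p q + dist p q) := by
        gcongr
        · exact hB' _ (mem_image_of_mem φ hpQ)
        · refine (mul_dist_perspective_le hp.ne' hq).trans ?_
          gcongr
          · exact (norm_nonneg _).trans (hB _ hpQ)
          · exact hB _ hpQ
    _ = (B' + K * (B + 1)) * dist p q := by ring
    _ ≤ (B' + K * (B + 1)).toNNReal * dist p q := by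
        gcongr
        exact Real.le_coe_toNNReal _

end Perspective

section Hemisphere

variable {E : Type*} [NormedAddCommGroup E]

variable (E) in
/-- The compactification of `E` by the sphere of its directions: the points of positive first
coordinate are those of `E`, see `toHemisphere`, and the others are at infinity. -/
def hemisphere : Set (ℝ × E) := {q | 0 ≤ q.1 ∧ q.1 + ‖q.2‖ = 1}

theorem one_add_norm_pos (x : E) : 0 < 1 + ‖x‖ := by positivity

theorem norm_le_one_of_mem_hemisphere {q : ℝ × E} (hq : q ∈ hemisphere E) : ‖q‖ ≤ 1 := by
  have h := hq.2
  refine max_le ?_ (by linarith [hq.1])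
  rw [Real.norm_of_nonneg hq.1]
  linarith [norm_nonneg q.2]

theorem isCompact_hemisphere [ProperSpace E] : IsCompact (hemisphere E) := by
  refine isCompact_of_isClosed_isBounded ?_ ((isBounded_iff_forall_norm_le).2
    ⟨1, fun _ => norm_le_one_of_mem_hemisphere⟩)
  exact (isClosed_le continuous_const continuous_fst).inter
    (isClosed_eq (by fun_prop) continuous_const)

variable [NormedSpace ℝ E]

/-- The embedding `x ↦ (1, x) / (1 + ‖x‖)` of `E` into the hemisphere. -/
noncomputable def toHemisphere (x : E) : ℝ × E := perspective (1 + ‖x‖, x)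

theorem toHemisphere_mem (x : E) : toHemisphere x ∈ hemisphere E := by
  have hx := one_add_norm_pos x
  refine ⟨by simp [toHemisphere, hx.le], ?_⟩
  simp only [toHemisphere, perspective, Prod.smul_mk, norm_smul, norm_inv,
    Real.norm_of_nonneg hx.le, smul_eq_mul]
  field_simp

theorem continuous_toHemisphere : Continuous (toHemisphere : E → ℝ × E) :=
  ((by fun_prop : Continuous fun x : E => 1 + ‖x‖).inv₀ fun x => (one_add_norm_pos x).ne').smul
    (by fun_prop)

theorem mul_dist_toHemisphere_le (x y : E) :
    (1 + ‖y‖) * dist (toHemisphere x) (toHemisphere y) ≤ 2 * dist x y := by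
  have hnorm : dist (1 + ‖x‖) (1 + ‖y‖) ≤ dist x y := by
    rw [dist_add_left]
    exact (dist_norm_norm_le x y).trans_eq (dist_eq_norm x y).symm
  calc (1 + ‖y‖) * dist (toHemisphere x) (toHemisphere y)
      ≤ ‖toHemisphere x‖ * dist (1 + ‖x‖) (1 + ‖y‖) + dist x y :=
        mul_dist_perspective_le (p := (1 + ‖x‖, x)) (q := (1 + ‖y‖, y)) (one_add_norm_pos x).ne'
          (one_add_norm_pos y)
    _ ≤ 1 * dist x y + dist x y := by
        gcongr
        exact norm_le_one_of_mem_hemisphere (toHemisphere_mem x)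
    _ = 2 * dist x y := by ring

end Hemisphere

section Global

variable {E : Type*} [NormedAddCommGroup E] [NormedSpace ℝ E] {X C : Set E}

/-- The set `X` is Lipschitz normally embedded near the point `q` of the hemisphere. -/
def IsLNENear (X : Set E) (q : ℝ × E) : Prop :=
  ∃ L : ℝ≥0, ∃ S ∈ 𝓝 q, ∀ x ∈ X, ∀ y ∈ X, toHemisphere x ∈ S → toHemisphere y ∈ S →
    innerDist X x y ≤ L * edist x y

theorem IsLNENear.connectedComponentIn {q : ℝ × E} (h : IsLNENear X q) (x₀ : E) :
    IsLNENear (connectedComponentIn X x₀) q := by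
  obtain ⟨L, S, hS, hL⟩ := h
  exact ⟨L, S, hS, fun x hx y hy hxS hyS => (innerDist_connectedComponentIn_le hx y).trans <|
    hL x (connectedComponentIn_subset _ _ hx) y (connectedComponentIn_subset _ _ hy) hxS hyS⟩

theorem innerDist_ne_top_of_isLNENear (hC : IsPreconnected C)
    (hnear : ∀ q ∈ hemisphere E, IsLNENear C q) {x y : E} (hx : x ∈ C) (hy : y ∈ C) :
    innerDist C x y ≠ ⊤ := by
  refine hC.induction₂ (fun x y => innerDist C x y ≠ ⊤) (fun x hx => ?_)
    (fun x y z _ _ _ hxy hyz => ?_) (fun x y _ _ hxy => ?_) hx hy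
  · obtain ⟨L, S, hS, hL⟩ := hnear (toHemisphere x) (toHemisphere_mem x)
    have hev : ∀ᶠ y in 𝓝[C] x, toHemisphere y ∈ S :=
      nhdsWithin_le_nhds (continuous_toHemisphere.continuousAt hS)
    filter_upwards [hev, self_mem_nhdsWithin] with y hyS hyC
    exact ne_top_of_le_ne_top (ENNReal.mul_ne_top ENNReal.coe_ne_top (edist_ne_top x y))
      (hL x hx y hyC (mem_of_mem_nhds hS) hyS)
  · exact ne_top_of_le_ne_top (ENNReal.add_ne_top.2 ⟨hxy, hyz⟩) (innerDist_triangle _ _ _ _)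
  · rwa [innerDist_comm]

theorem exists_innerDist_le_mul_one_add_norm [ProperSpace E] (hC : IsPreconnected C)
    (hnear : ∀ q ∈ hemisphere E, IsLNENear C q) {a : E} (ha : a ∈ C) :
    ∃ M : ℝ≥0, ∀ x ∈ C, innerDist C x a ≤ M * (1 + ‖x‖₊ : ℝ≥0) := by
  refine exists_forall_of_eventually_comap (P := fun (M : ℝ≥0) x => x ∈ C →
    innerDist C x a ≤ M * (1 + ‖x‖₊ : ℝ≥0)) isCompact_hemisphere toHemisphere_mem
    (fun x M M' hM h hx => (h hx).trans (by gcongr)) fun q hq => ?_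
  obtain ⟨L, S, hS, hL⟩ := hnear q hq
  rcases (C ∩ toHemisphere ⁻¹' S).eq_empty_or_nonempty with hempty | ⟨y, hy, hyS⟩
  · exact ⟨0, mem_of_superset (preimage_mem_comap hS) fun x hxS hx =>
      (hempty.subset ⟨hx, hxS⟩).elim⟩
  lift innerDist C y a to ℝ≥0 using innerDist_ne_top_of_isLNENear hC hnear hy ha with T hT
  refine ⟨L * (1 + ‖y‖₊) + T, mem_of_superset (preimage_mem_comap hS) fun x hxS hx => ?_⟩
  have hxy : nndist x y ≤ (1 + ‖y‖₊) * (1 + ‖x‖₊) := by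
    rw [← NNReal.coe_le_coe]
    push_cast
    nlinarith [dist_le_norm_add_norm x y, norm_nonneg x, norm_nonneg y]
  calc innerDist C x a ≤ L * edist x y + T :=
        hT ▸ (innerDist_triangle _ _ _ _).trans (by gcongr; exact hL x hx y hy hxS hyS)
    _ = (L * nndist x y + T * 1 : ℝ≥0) := by
        rw [edist_nndist]
        push_cast
        ring
    _ ≤ (L * ((1 + ‖y‖₊) * (1 + ‖x‖₊)) + T * (1 + ‖x‖₊) : ℝ≥0) := by
        gcongr
        exact le_self_add
    _ = (L * (1 + ‖y‖₊) + T : ℝ≥0) * (1 + ‖x‖₊ : ℝ≥0) := by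
        push_cast
        ring

theorem exists_innerDist_le_of_ne [ProperSpace E] (hC : IsPreconnected C)
    (hnear : ∀ q ∈ hemisphere E, IsLNENear C q) {q q' : ℝ × E} (hne : q ≠ q') :
    ∃ L : ℝ≥0, ∀ᶠ p : E × E in comap (Prod.map toHemisphere toHemisphere) (𝓝 (q, q')),
      p.1 ∈ C → p.2 ∈ C → innerDist C p.1 p.2 ≤ L * edist p.1 p.2 := by
  rcases C.eq_empty_or_nonempty with rfl | ⟨a, ha⟩
  · exact ⟨0, Eventually.of_forall fun _ h => h.elim⟩
  obtain ⟨M, hM⟩ := exists_innerDist_le_mul_one_add_norm hC hnear ha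
  obtain ⟨ε, hε, hεq⟩ := exists_between (dist_pos.2 hne)
  lift ε to ℝ≥0 using hε.le
  have hfar : ∀ᶠ z : (ℝ × E) × (ℝ × E) in 𝓝 (q, q'), ε < dist z.1 z.2 :=
    continuous_dist.continuousAt.eventually_const_lt hεq
  refine ⟨4 * M / ε, (hfar.comap _).mono fun ⟨x, y⟩ hxy hx hy => ?_⟩
  have norm_le : ∀ x y : E, ε < dist (toHemisphere x) (toHemisphere y) →
      1 + ‖y‖₊ ≤ 2 / ε * nndist x y := fun x y h => by
    rw [div_mul_eq_mul_div, le_div_iff₀ (NNReal.coe_pos.1 hε), ← NNReal.coe_le_coe]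
    push_cast
    exact (mul_le_mul_of_nonneg_left h.le (by positivity)).trans (mul_dist_toHemisphere_le x y)
  have hy' := norm_le x y hxy
  have hx' := norm_le y x (by rwa [dist_comm])
  calc innerDist C x y ≤ innerDist C x a + innerDist C y a :=
        innerDist_comm C y a ▸ innerDist_triangle C x a y
    _ ≤ M * (1 + ‖x‖₊ : ℝ≥0) + M * (1 + ‖y‖₊ : ℝ≥0) := add_le_add (hM x hx) (hM y hy)
    _ ≤ M * (2 / ε * nndist y x : ℝ≥0) + M * (2 / ε * nndist x y : ℝ≥0) := by gcongr
    _ = (4 * M / ε : ℝ≥0) * edist x y := by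
        rw [edist_nndist, nndist_comm y x]
        norm_cast
        ring

/-- The compactness of `hemisphere E × hemisphere E` reduces the claim to pairs of points near a
given pair `(q, q')`: for `q = q'` it is the hypothesis, and for `q ≠ q'` the outer distance is at
least linear in the norms of the points, while the inner distance is at most linear in them. -/
theorem isLNE_of_isLNENear [ProperSpace E] (hC : IsPreconnected C)
    (hnear : ∀ q ∈ hemisphere E, IsLNENear C q) : IsLNE C := by
  have hloc : ∀ z ∈ hemisphere E ×ˢ hemisphere E, ∃ L : ℝ≥0,
      ∀ᶠ p : E × E in comap (Prod.map toHemisphere toHemisphere) (𝓝 z),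
        p.1 ∈ C → p.2 ∈ C → innerDist C p.1 p.2 ≤ L * edist p.1 p.2 := by
    rintro ⟨q, q'⟩ ⟨hq, -⟩
    rcases eq_or_ne q q' with rfl | hne
    · obtain ⟨L, S, hS, hL⟩ := hnear q hq
      exact ⟨L, mem_of_superset (preimage_mem_comap (prod_mem_nhds hS hS))
        fun p hp hx hy => hL _ hx _ hy hp.1 hp.2⟩
    · exact exists_innerDist_le_of_ne hC hnear hne
  obtain ⟨L, hL⟩ := exists_forall_of_eventually_comap
    (P := fun (L : ℝ≥0) p => p.1 ∈ C → p.2 ∈ C → innerDist C p.1 p.2 ≤ L * edist p.1 p.2)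
    (isCompact_hemisphere.prod isCompact_hemisphere)
    (fun p : E × E => ⟨toHemisphere_mem p.1, toHemisphere_mem p.2⟩)
    (fun p L L' hLL' h hx hy => (h hx hy).trans (by gcongr)) hloc
  refine ⟨L + 1, by positivity, fun x hx y hy => (hL (x, y) hx hy).trans ?_⟩
  rw [ENNReal.ofReal_add L.coe_nonneg zero_le_one, ENNReal.ofReal_coe_nnreal]
  gcongr
  exact le_self_add

end Global

section Straightening

variable {F E Y : Type*} [NormedAddCommGroup F] [NormedSpace ℝ F] [NormedAddCommGroup E]
  [NormedSpace ℝ E] [NormedAddCommGroup Y] [NormedSpace ℝ Y]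

/-- At the point `q`, the partial derivative of `G` in the direction of `E` is surjective. -/
def IsSliceSubmersionAt (G : F × E → Y) (q : F × E) : Prop :=
  Function.Surjective fun w : E => fderiv ℝ G q (0, w)

theorem isSliceSubmersionAt_iff {G : F × E → Y} {s : F} {u : E}
    (hG : DifferentiableAt ℝ G (s, u)) :
    IsSliceSubmersionAt G (s, u) ↔ Function.Surjective (fderiv ℝ (fun v => G (s, v)) u) := by
  have hslice : HasFDerivAt (fun v => G (s, v))
      ((fderiv ℝ G (s, u)).comp (ContinuousLinearMap.inr ℝ F E)) u :=
    hG.hasFDerivAt.comp u (hasFDerivAt_prodMk_right s u)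
  rw [hslice.fderiv]
  rfl

theorem IsSliceSubmersionAt.exists_mem_ker {G : F × E → Y} {q : F × E}
    (h : IsSliceSubmersionAt G q) (s : F) : ∃ w : E, fderiv ℝ G q (s, w) = 0 := by
  obtain ⟨w, hw : fderiv ℝ G q (0, w) = -fderiv ℝ G q (s, 0)⟩ := h (-fderiv ℝ G q (s, 0))
  have hsplit : (s, w) = (s, (0 : E)) + (0, w) := by simp
  exact ⟨w, by rw [hsplit, map_add, hw, add_neg_cancel]⟩

/-- The chart `Φ` at the zero `a` of `G`, of class `C^n` and preserving the first coordinate up to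
a translation, turns `G` into its derivative at `a`. -/
structure IsStraightening (n : WithTop ℕ∞) (G : F × E → Y) (a : F × E)
    (Φ : OpenPartialHomeomorph (F × E) (F × E)) : Prop where
  mem_source : a ∈ Φ.source
  map_center : Φ a = 0
  contDiffOn : ContDiffOn ℝ n Φ Φ.source
  contDiffOn_symm : ContDiffOn ℝ n Φ.symm Φ.target
  fderiv_center : fderiv ℝ Φ a = ContinuousLinearMap.id ℝ (F × E)
  fst_apply : ∀ q, (Φ q).1 = q.1 - a.1
  fderiv_apply : ∀ q, fderiv ℝ G a (Φ q) = G q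

theorem exists_isStraightening [CompleteSpace F] [CompleteSpace E] [FiniteDimensional ℝ Y]
    {n : WithTop ℕ∞} (hn : n ≠ 0) (hn' : n ≠ ∞) {G : F × E → Y} (hG : ContDiff ℝ n G)
    {a : F × E} (ha : G a = 0) (hsub : IsSliceSubmersionAt G a) :
    ∃ Φ, IsStraightening n G a Φ := by
  obtain ⟨R, hR⟩ := ((fderiv ℝ G a).comp
    (ContinuousLinearMap.inr ℝ F E)).exists_rightInverse_of_surjective
      (LinearMap.range_eq_top.2 hsub)
  have hR' : ∀ y, fderiv ℝ G a (0, R y) = y := DFunLike.congr_fun hR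
  let φ : F × E → F × E := fun q => (q - a) + (0, R (G q - fderiv ℝ G a (q - a)))
  have hφ : ContDiff ℝ n φ := by fun_prop
  have hφ' : HasFDerivAt φ (ContinuousLinearEquiv.refl ℝ (F × E) : F × E →L[ℝ] F × E) a := by
    have hsub_a : HasFDerivAt (fun q => q - a) (ContinuousLinearMap.id ℝ (F × E)) a :=
      (hasFDerivAt_id a).sub_const a
    have hrem : HasFDerivAt (fun q => G q - fderiv ℝ G a (q - a)) (0 : F × E →L[ℝ] Y) a := by
      have hGa := (hG.differentiable hn).differentiableAt (x := a) |>.hasFDerivAt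
      refine (hGa.sub ((fderiv ℝ G a).hasFDerivAt.comp a hsub_a)).congr_fderiv ?_
      exact sub_self _
    refine (hsub_a.add (((ContinuousLinearMap.inr ℝ F E).comp R).hasFDerivAt.comp a
      hrem)).congr_fderiv ?_
    ext <;> simp
  let Φ := (hφ.contDiffAt.toOpenPartialHomeomorph φ hφ' hn).restrContDiff ℝ n hn'
  exact ⟨Φ, {
    mem_source := ⟨hφ.contDiffAt.mem_toOpenPartialHomeomorph_source hφ' hn, hφ.contDiffAt,
      hφ.contDiffAt.to_localInverse hφ' hn⟩
    map_center := by
      change φ a = 0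
      simp [φ, ha]
    contDiffOn := OpenPartialHomeomorph.contDiffOn_restrContDiff_source ℝ _ hn'
    contDiffOn_symm := OpenPartialHomeomorph.contDiffOn_restrContDiff_target ℝ _ hn'
    fderiv_center := hφ'.fderiv
    fst_apply := fun q => by
      change (φ q).1 = q.1 - a.1
      simp [φ]
    fderiv_apply := fun q => by
      change fderiv ℝ G a (φ q) = G q
      rw [map_add, hR', add_sub_cancel] }⟩

end Straightening

section Homogeneous

variable {E Y : Type*} [NormedAddCommGroup E] [NormedSpace ℝ E]
  [NormedAddCommGroup Y] [NormedSpace ℝ Y]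

/-- `H` is positively homogeneous of degree `d`. -/
def IsPosHomogeneous (H : E → Y) (d : ℕ) : Prop :=
  ∀ t : ℝ, 0 < t → ∀ q, H (t • q) = t ^ d • H q

namespace IsPosHomogeneous

theorem map_smul_eq_zero_iff {H : E → Y} {d : ℕ} (hH : IsPosHomogeneous H d) {t : ℝ}
    (ht : 0 < t) (q : E) : H (t • q) = 0 ↔ H q = 0 := by
  rw [hH t ht q, smul_eq_zero_iff_right (pow_pos ht d).ne']

theorem fderiv_apply_self {H : E → Y} {d : ℕ} (hH : IsPosHomogeneous H d) {q : E}
    (hdiff : DifferentiableAt ℝ H q) (hq : H q = 0) : fderiv ℝ H q q = 0 := by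
  have hray : HasDerivAt (fun t : ℝ => H (t • q)) (fderiv ℝ H q q) 1 := by
    rw [← one_smul ℝ q] at hdiff
    simpa [Function.comp_def] using
      hdiff.hasFDerivAt.comp_hasDerivAt (1 : ℝ) ((hasDerivAt_id 1).smul_const q)
  refine hray.unique ((hasDerivAt_const (1 : ℝ) (0 : Y)).congr_of_eventuallyEq ?_)
  filter_upwards [lt_mem_nhds one_pos] with t ht
  rw [(hH.map_smul_eq_zero_iff ht q).2 hq]

theorem isSliceSubmersionAt_smul {H : ℝ × E → Y} {d : ℕ} (hH : IsPosHomogeneous H d) {t : ℝ}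
    (ht : 0 < t) {q : ℝ × E} (hdiff : DifferentiableAt ℝ H q) (hq : IsSliceSubmersionAt H q) :
    IsSliceSubmersionAt H (t • q) := by
  have hscale : t • fderiv ℝ H (t • q) = t ^ d • fderiv ℝ H q := by
    rw [← fderiv_comp_smul, funext (hH t ht), fderiv_fun_const_smul hdiff]
  intro y
  obtain ⟨w, hw : fderiv ℝ H q (0, w) = y⟩ := hq y
  have hvec : ((0 : ℝ), ((t ^ d)⁻¹ * t) • w) = (t ^ d)⁻¹ • t • ((0 : ℝ), w) := by
    simp [mul_smul]
  refine ⟨((t ^ d)⁻¹ * t) • w, ?_⟩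
  calc fderiv ℝ H (t • q) (0, ((t ^ d)⁻¹ * t) • w)
      = (t ^ d)⁻¹ • (t • fderiv ℝ H (t • q)) (0, w) := by
        rw [hvec, map_smul, map_smul, smul_apply]
    _ = y := by
        rw [hscale, smul_apply, hw, inv_smul_smul₀ (pow_pos ht d).ne']

end IsPosHomogeneous

end Homogeneous

section LocalLNE

variable {E Y : Type*} [NormedAddCommGroup E] [NormedSpace ℝ E]
  [NormedAddCommGroup Y] [NormedSpace ℝ Y]

theorem coneExtension_toHemisphere_snd (x : E) :
    coneExtension Prod.snd (1 + ‖x‖, x) = x := by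
  simp [coneExtension, perspective, smul_inv_smul₀ (one_add_norm_pos x).ne']

/-- The cone extensions of `φ` and `ψ` are Lipschitz, and identify `X` near `q₀` with the convex
cone over `Q`. -/
theorem isLNENear_of_lipschitzOnWith {X : Set E} {q₀ : ℝ × E} {φ ψ : ℝ × E → E}
    {U Q : Set (ℝ × E)} {K K' : ℝ≥0} (hU : U ∈ 𝓝 q₀) (hU' : Bornology.IsBounded U)
    (hφ : LipschitzOnWith K φ U) (hQ : Convex ℝ Q) (hQ' : Bornology.IsBounded Q)
    (hψ : LipschitzOnWith K' ψ Q)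
    (hφQ : ∀ x ∈ X, toHemisphere x ∈ U → ((toHemisphere x).1, φ (toHemisphere x)) ∈ Q)
    (hψφ : ∀ x ∈ X, toHemisphere x ∈ U →
      ψ ((toHemisphere x).1, φ (toHemisphere x)) = (toHemisphere x).2)
    (hψX : ∀ p : ℝ × E, 0 < p.1 → perspective p ∈ Q → coneExtension ψ p ∈ X) :
    IsLNENear X q₀ := by
  obtain ⟨L, hL⟩ := exists_lipschitzOnWith_coneExtension hφ hU'
  obtain ⟨L', hL'⟩ := exists_lipschitzOnWith_coneExtension hψ hQ'
  let lift : E → ℝ × E := fun x => (1 + ‖x‖, x)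
  let flat : E → ℝ × E := fun x => (1 + ‖x‖, coneExtension φ (lift x))
  have hnorm : LipschitzWith (0 + 1) fun x : E => 1 + ‖x‖ :=
    (LipschitzWith.const 1).add lipschitzWith_one_norm
  have hlift : LipschitzWith (max (0 + 1) 1) lift := hnorm.prodMk LipschitzWith.id
  obtain ⟨L₁, hflat⟩ : ∃ L₁, LipschitzOnWith L₁ flat (toHemisphere ⁻¹' U) :=
    ⟨_, hnorm.lipschitzOnWith.prodMk <|
      hL.comp hlift.lipschitzOnWith fun x hx => ⟨one_add_norm_pos x, hx⟩⟩
  have hpersp : ∀ x, perspective (flat x) = ((toHemisphere x).1, φ (toHemisphere x)) := fun x => by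
    simp only [flat, lift, coneExtension, perspective, toHemisphere, Prod.smul_mk, smul_eq_mul,
      mul_one, inv_smul_smul₀ (one_add_norm_pos x).ne']
  have hback : ∀ x ∈ X, toHemisphere x ∈ U → coneExtension ψ (flat x) = x := fun x hx hxU => by
    rw [coneExtension, hpersp, hψφ x hx hxU]
    exact coneExtension_toHemisphere_snd x
  refine ⟨L' * L₁, U, hU, fun x hx y hy hxU hyU => ?_⟩
  calc innerDist X x y = innerDist X (coneExtension ψ (flat x)) (coneExtension ψ (flat y)) := by
        rw [hback x hx hxU, hback y hy hyU]
    _ ≤ L' * edist (flat x) (flat y) :=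
        innerDist_le_of_lipschitzOnWith_convex (convex_perspective_preimage hQ) hL'
          (fun p hp => hψX p hp.1 hp.2)
          ⟨one_add_norm_pos x, hpersp x ▸ hφQ x hx hxU⟩
          ⟨one_add_norm_pos y, hpersp y ▸ hφQ y hy hyU⟩
    _ ≤ L' * (L₁ * edist x y) := by
        gcongr
        exact hflat hxU hyU
    _ = _ := by rw [ENNReal.coe_mul, mul_assoc]

/-- The affine part of the projective zero set of the homogeneous map `H`. -/
def affineZeros (H : ℝ × E → Y) : Set E := {x | H (1, x) = 0}

theorem IsPosHomogeneous.map_toHemisphere_eq_zero_iff {H : ℝ × E → Y} {d : ℕ}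
    (hH : IsPosHomogeneous H d) (x : E) : H (toHemisphere x) = 0 ↔ x ∈ affineZeros H :=
  hH.map_smul_eq_zero_iff (inv_pos.2 (one_add_norm_pos x)) _

theorem IsPosHomogeneous.smul_snd_mem_affineZeros_iff {H : ℝ × E → Y} {d : ℕ}
    (hH : IsPosHomogeneous H d) {q : ℝ × E} (hq : 0 < q.1) :
    q.1⁻¹ • q.2 ∈ affineZeros H ↔ H q = 0 := by
  rw [← hH.map_smul_eq_zero_iff (inv_pos.2 hq) q]
  have hsmul : q.1⁻¹ • q = (1, q.1⁻¹ • q.2) := by ext <;> simp [hq.ne']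
  rw [hsmul]
  rfl

theorem isLNENear_affineZeros_of_ne_zero {H : ℝ × E → Y} {d : ℕ} (hH : IsPosHomogeneous H d)
    (hc : Continuous H) {q₀ : ℝ × E} (hq₀ : H q₀ ≠ 0) : IsLNENear (affineZeros H) q₀ :=
  ⟨0, {q | H q ≠ 0}, (hc.continuousAt).eventually_ne hq₀,
    fun x hx _ _ hxS _ => (hxS ((hH.map_toHemisphere_eq_zero_iff x).2 hx)).elim⟩

theorem IsStraightening.coneExtension_symm_mem_affineZeros {n : WithTop ℕ∞} {H : ℝ × E → Y}
    {d : ℕ} {q₀ : ℝ × E} {Φ : OpenPartialHomeomorph (ℝ × E) (ℝ × E)}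
    (hΦ : IsStraightening n H q₀ Φ) (hH : IsPosHomogeneous H d) {p : ℝ × E} (hp : 0 < p.1)
    (htarget : perspective p - (q₀.1, 0) ∈ Φ.target)
    (hker : fderiv ℝ H q₀ (perspective p - (q₀.1, 0)) = 0) :
    coneExtension (fun p => (Φ.symm (p - (q₀.1, 0))).2) p ∈ affineZeros H := by
  set z := Φ.symm (perspective p - (q₀.1, 0))
  have hΦz : Φ z = perspective p - (q₀.1, 0) := Φ.right_inv htarget
  have hz₁ : z.1 = p.1⁻¹ := by
    have hfst : z.1 - q₀.1 = p.1⁻¹ - q₀.1 := by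
      rw [← hΦ.fst_apply, hΦz, Prod.fst_sub, perspective_fst]
    exact sub_left_inj.1 hfst
  have hHz : H z = 0 := by rw [← hΦ.fderiv_apply, hΦz, hker]
  have hmem := (hH.smul_snd_mem_affineZeros_iff (hz₁ ▸ inv_pos.2 hp)).2 hHz
  rwa [hz₁, inv_inv] at hmem

theorem isLNENear_affineZeros_of_isStraightening {H : ℝ × E → Y} {d : ℕ}
    (hH : IsPosHomogeneous H d) {q₀ : ℝ × E} {Φ : OpenPartialHomeomorph (ℝ × E) (ℝ × E)}
    (hΦ : IsStraightening 1 H q₀ Φ) : IsLNENear (affineZeros H) q₀ := by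
  have hq₀ := hΦ.mem_source
  have hsymm : ContDiffAt ℝ 1 Φ.symm 0 :=
    hΦ.contDiffOn_symm.contDiffAt (Φ.open_target.mem_nhds (hΦ.map_center ▸ Φ.map_source hq₀))
  obtain ⟨K, U, hU, hK⟩ :=
    (hΦ.contDiffOn.contDiffAt (Φ.open_source.mem_nhds hq₀)).exists_lipschitzOnWith
  obtain ⟨K', W, hW, hK'⟩ := hsymm.exists_lipschitzOnWith
  obtain ⟨ε, hε, hεW⟩ := Metric.mem_nhds_iff.1 <|
    inter_mem hW (Φ.open_target.mem_nhds (hΦ.map_center ▸ Φ.map_source hq₀))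
  let shift : ℝ × E → ℝ × E := fun p => p - (q₀.1, 0)
  let Q : Set (ℝ × E) := shift ⁻¹' (LinearMap.ker (fderiv ℝ H q₀).toLinearMap ∩ ball 0 ε)
  have hshift : LipschitzWith 1 shift := (IsometryEquiv.subRight _).isometry.lipschitz
  have hstraight : ∀ q, shift (q.1, (Φ q).2) = Φ q := fun q => by
    ext <;> simp [shift, hΦ.fst_apply]
  have hQconv : Convex ℝ Q := by
    simpa only [Q, shift, sub_eq_add_neg] using
      ((Submodule.convex _).inter (convex_ball 0 ε)).translate_preimage_left (-(q₀.1, (0 : E)))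
  have hnear : U ∩ ball q₀ 1 ∩ (Φ.source ∩ Φ ⁻¹' ball 0 ε) ∈ 𝓝 q₀ :=
    inter_mem (inter_mem hU (ball_mem_nhds q₀ one_pos)) <|
      (Φ.continuousOn.isOpen_inter_preimage Φ.open_source isOpen_ball).mem_nhds
        ⟨hq₀, by simpa [hΦ.map_center] using hε⟩
  refine isLNENear_of_lipschitzOnWith (φ := fun q => (Φ q).2)
    (ψ := fun p => (Φ.symm (shift p)).2) (Q := Q) hnear
    (isBounded_ball.subset fun q hq => hq.1.2)
    (LipschitzWith.prod_snd.comp_lipschitzOnWith (hK.mono fun q hq => hq.1.1)) hQconv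
    (isBounded_ball.subset fun p hp => mem_ball_iff_norm.2 (mem_ball_zero_iff.1 hp.2))
    (LipschitzWith.prod_snd.comp_lipschitzOnWith <|
      hK'.comp hshift.lipschitzOnWith fun p hp => (hεW hp.2).1) ?_ ?_
    fun p hp hpQ => hΦ.coneExtension_symm_mem_affineZeros hH hp (hεW hpQ.2).2 hpQ.1
  · intro x hx hxU
    refine ⟨?_, ?_⟩
    · rw [hstraight]
      exact (hΦ.fderiv_apply _).trans ((hH.map_toHemisphere_eq_zero_iff x).2 hx)
    · rw [hstraight]
      exact hxU.2.2
  · intro x _ hxU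
    rw [hstraight, Φ.left_inv hxU.2.1]

theorem isLNE_connectedComponentIn_affineZeros [FiniteDimensional ℝ E] [FiniteDimensional ℝ Y]
    {H : ℝ × E → Y} {d : ℕ} (hH : IsPosHomogeneous H d) (hsmooth : ContDiff ℝ 1 H)
    (hinfinity : ∀ u ≠ 0, H (0, u) = 0 → IsSliceSubmersionAt H (0, u))
    (hfinite : ∀ x ∈ affineZeros H, IsSliceSubmersionAt H (1, x)) (x₀ : E) :
    IsLNE (connectedComponentIn (affineZeros H) x₀) := by
  have : ProperSpace E := FiniteDimensional.proper_real E
  have : CompleteSpace E := FiniteDimensional.complete ℝ E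
  refine isLNE_of_isLNENear isPreconnected_connectedComponentIn fun q hq =>
    IsLNENear.connectedComponentIn ?_ x₀
  by_cases hzero : H q = 0
  · have hsub : IsSliceSubmersionAt H q := by
      rcases hq.1.eq_or_lt with h₀ | hpos
      · rw [← Prod.mk.eta (p := q), ← h₀] at hzero ⊢
        refine hinfinity q.2 (fun hq₂ => ?_) hzero
        simpa [← h₀, hq₂] using hq.2
      · have hscale : q.1 • ((1 : ℝ), q.1⁻¹ • q.2) = q := by ext <;> simp [hpos.ne']
        rw [← hscale]
        exact hH.isSliceSubmersionAt_smul hpos (hsmooth.differentiable one_ne_zero _)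
          (hfinite _ ((hH.smul_snd_mem_affineZeros_iff hpos).2 hzero))
    obtain ⟨Φ, hΦ⟩ := exists_isStraightening one_ne_zero (by decide) hsmooth hzero hsub
    exact isLNENear_affineZeros_of_isStraightening hH hΦ
  · exact isLNENear_affineZeros_of_ne_zero hH hsmooth.continuous hzero

end LocalLNE

section Infinity

variable {E Y : Type*} [NormedAddCommGroup E] [NormedSpace ℝ E]
  [NormedAddCommGroup Y] [NormedSpace ℝ Y]

theorem IsStraightening.mem_closure_iff {n : WithTop ℕ∞} {G : ℝ × E → Y} {u : E}
    {Φ : OpenPartialHomeomorph (ℝ × E) (ℝ × E)} (hΦ : IsStraightening n G (0, u) Φ)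
    (hG : Continuous G) (hsub : IsSliceSubmersionAt G (0, u)) {x : ℝ × E} (hx : x ∈ Φ.source) :
    x ∈ closure {q | 0 < q.1 ∧ G q = 0} ↔ 0 ≤ x.1 ∧ G x = 0 := by
  refine ⟨fun hmem => ?_, fun ⟨hx₁, hGx⟩ => ?_⟩
  · have hclosed : IsClosed {q : ℝ × E | 0 ≤ q.1 ∧ G q = 0} :=
      (isClosed_le continuous_const continuous_fst).inter (isClosed_eq hG continuous_const)
    exact hclosed.closure_subset_iff.2 (fun q hq => ⟨hq.1.le, hq.2⟩) hmem
  · -- Move `x` into the interior, inside the zero set, along a straight line in the chart.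
    obtain ⟨w, hw⟩ := hsub.exists_mem_ker 1
    have hline : Tendsto (fun t : ℝ => Φ x + t • ((1 : ℝ), w)) (𝓝[>] 0) (𝓝 (Φ x)) := by
      have hcont : Continuous fun t : ℝ => Φ x + t • ((1 : ℝ), w) := by fun_prop
      simpa using (hcont.tendsto 0).mono_left nhdsWithin_le_nhds
    have hxt := Φ.map_source hx
    have hcurve := (Φ.continuousAt_symm hxt).tendsto.comp hline
    rw [Φ.left_inv hx] at hcurve
    refine mem_closure_of_tendsto hcurve ?_
    filter_upwards [hline (Φ.open_target.mem_nhds hxt), self_mem_nhdsWithin] with t ht htpos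
    have hchart := Φ.right_inv ht
    constructor
    · have hfst := congrArg Prod.fst hchart
      simp only [hΦ.fst_apply, sub_zero, Prod.fst_add, Prod.smul_fst, smul_eq_mul,
        mul_one] at hfst
      exact hfst ▸ add_pos_of_nonneg_of_pos hx₁ htpos
    · rw [Function.comp_apply, ← hΦ.fderiv_apply, hchart, map_add, map_smul, hw, smul_zero,
        add_zero, hΦ.fderiv_apply, hGx]

theorem IsStraightening.isBoundaryChart {G : ℝ × E → Y} {u : E}
    {Φ : OpenPartialHomeomorph (ℝ × E) (ℝ × E)} (hΦ : IsStraightening ω G (0, u) Φ)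
    (hG : Continuous G) (hsub : IsSliceSubmersionAt G (0, u)) :
    IsBoundaryChart (closure {q | 0 < q.1 ∧ G q = 0}) (0, u) Φ
      (LinearMap.ker (fderiv ℝ G (0, u)).toLinearMap) (ContinuousLinearMap.fst ℝ ℝ E) where
  mem_source := hΦ.mem_source
  map_center := hΦ.map_center
  smooth := hΦ.contDiffOn.of_le le_top
  smooth_symm := hΦ.contDiffOn_symm.of_le le_top
  nontrivial := by
    obtain ⟨w, hw⟩ := hsub.exists_mem_ker 1
    exact ⟨(1, w), hw, one_ne_zero⟩
  mem_iff x hx := by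
    rw [hΦ.mem_closure_iff hG hsub hx, and_comm]
    simp [hΦ.fst_apply, hΦ.fderiv_apply]

theorem IsSliceSubmersionAt.ker_sup_bot_prod {G : ℝ × E → Y} {q : ℝ × E}
    (hsub : IsSliceSubmersionAt G q) {T : Submodule ℝ E}
    (hT : ∀ v, fderiv ℝ G q v = 0 → v.2 ∈ T) :
    LinearMap.ker (fderiv ℝ G q).toLinearMap ⊔ (⊥ : Submodule ℝ ℝ).prod T
      = (⊤ : Submodule ℝ ℝ).prod T := by
  refine le_antisymm (sup_le (fun v hv => ⟨trivial, hT v hv⟩)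
    (Submodule.prod_mono bot_le le_rfl)) ?_
  rintro ⟨s, w⟩ ⟨-, hw⟩
  obtain ⟨w', hw'⟩ := hsub.exists_mem_ker s
  exact Submodule.mem_sup.2 ⟨(s, w'), hw', (0, w - w'),
    ⟨rfl, T.sub_mem hw (hT _ hw')⟩, by simp⟩

theorem isPSubmanifoldAt_closure [CompleteSpace E] [FiniteDimensional ℝ Y] {G : ℝ × E → Y}
    (hG : ContDiff ℝ ω G) {u : E} (hu : G (0, u) = 0) (hsub : IsSliceSubmersionAt G (0, u))
    (htangent : ∀ v, fderiv ℝ G (0, u) v = 0 → v.2 ∈ sphereTangent u) :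
    IsPSubmanifoldAt (closure {q | 0 < q.1 ∧ G q = 0}) u := by
  obtain ⟨Φ, hΦ⟩ := exists_isStraightening (n := ω) (by decide) (by decide) hG hu hsub
  refine ⟨Φ, _, _, hΦ.isBoundaryChart hG.continuous hsub, fun x _ _ => ?_, ?_⟩
  · simp [hΦ.fst_apply]
  · rw [hΦ.fderiv_center]
    exact hsub.ker_sup_bot_prod htangent

theorem asymptoticSet_nonempty [ProperSpace E] {X : Set E} (hX : ¬ Bornology.IsBounded X) :
    (asymptoticSet X).Nonempty := by
  have hfar : ∀ k : ℕ, ∃ x ∈ X, (k : ℝ) + 1 ≤ ‖x‖ := by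
    intro k
    by_contra! hk
    exact hX (isBounded_iff_forall_norm_le.2 ⟨k + 1, fun x hx => (hk x hx).le⟩)
  choose x hxX hxk using hfar
  have hpos : ∀ k, 0 < ‖x k‖ := fun k => lt_of_lt_of_le (by positivity) (hxk k)
  have hsphere : ∀ k, ‖x k‖⁻¹ • x k ∈ sphere (0 : E) 1 := fun k => by
    rw [mem_sphere_zero_iff_norm, norm_smul, norm_inv, norm_norm, inv_mul_cancel₀ (hpos k).ne']
  obtain ⟨u, -, φ, hφ, hu⟩ := (isCompact_sphere (0 : E) 1).tendsto_subseq hsphere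
  have hinv : Tendsto (fun k => ‖x k‖⁻¹) atTop (𝓝 0) :=
    tendsto_inv_atTop_zero.comp <| tendsto_atTop_mono hxk <|
      tendsto_atTop_add_const_right _ _ tendsto_natCast_atTop_atTop
  refine ⟨u, mem_closure_of_tendsto ((hinv.comp hφ.tendsto_atTop).prodMk_nhds hu)
    (Eventually.of_forall fun k => ⟨inv_pos.2 (hpos _), ?_, ?_⟩)⟩
  · exact mem_sphere_zero_iff_norm.1 (hsphere (φ k))
  · simpa only [Function.comp_apply, inv_inv, smul_inv_smul₀ (hpos (φ k)).ne'] using hxX _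

end Infinity

section SphericalEquation

variable {E Y : Type*} [NormedAddCommGroup E] [NormedAddCommGroup Y]

/-- The map whose zero set in `[0, ∞) × 𝕊` is the zero set of `H`. -/
def sphericalEquation (H : ℝ × E → Y) (q : ℝ × E) : Y × ℝ :=
  (H q, ‖q.2‖ ^ 2 - 1)

theorem sphericalEquation_eq_zero_iff {H : ℝ × E → Y} {q : ℝ × E} :
    sphericalEquation H q = 0 ↔ H q = 0 ∧ ‖q.2‖ = 1 := by
  rw [sphericalEquation, Prod.mk_eq_zero, sub_eq_zero,
    pow_eq_one_iff_of_nonneg (norm_nonneg _) two_ne_zero]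

variable [InnerProductSpace ℝ E] [NormedSpace ℝ Y]

theorem contDiff_sphericalEquation {n : WithTop ℕ∞} {H : ℝ × E → Y} (hH : ContDiff ℝ n H) :
    ContDiff ℝ n (sphericalEquation H) :=
  hH.prodMk ((contDiff_snd.norm_sq ℝ).sub contDiff_const)

theorem fderiv_sphericalEquation {H : ℝ × E → Y} {q : ℝ × E} (hH : DifferentiableAt ℝ H q)
    (v : ℝ × E) : fderiv ℝ (sphericalEquation H) q v
      = (fderiv ℝ H q v, fderiv ℝ (fun x : E => ‖x‖ ^ 2) q.2 v.2) := by
  have hnorm : HasFDerivAt (fun x : E => ‖x‖ ^ 2) (fderiv ℝ (fun x : E => ‖x‖ ^ 2) q.2) q.2 :=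
    (differentiableAt_id.norm_sq ℝ).hasFDerivAt
  have hprod := hH.hasFDerivAt.prodMk ((hnorm.comp q hasFDerivAt_snd).sub_const 1)
  exact congrArg (· v) hprod.fderiv

/-- By Euler's identity the radial direction is tangent to the cone `{H = 0}`, whereas it is
transverse to the sphere. -/
theorem isSliceSubmersionAt_sphericalEquation {H : ℝ × E → Y} {d : ℕ} {u : E}
    (hH : IsPosHomogeneous H d) (hdiff : DifferentiableAt ℝ H (0, u)) (hu : ‖u‖ = 1)
    (hzero : H (0, u) = 0) (hsub : IsSliceSubmersionAt H (0, u)) :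
    IsSliceSubmersionAt (sphericalEquation H) (0, u) := by
  rintro ⟨y, s⟩
  obtain ⟨w, hw : fderiv ℝ H (0, u) (0, w) = y⟩ := hsub y
  let D := fderiv ℝ (fun x : E => ‖x‖ ^ 2) u
  have hradial : D u = 2 := by simp [D, hu]
  refine ⟨w + ((s - D w) / 2) • u, ?_⟩
  have hsplit : ((0 : ℝ), w + ((s - D w) / 2) • u) = (0, w) + ((s - D w) / 2) • (0, u) := by simp
  calc fderiv ℝ (sphericalEquation H) (0, u) (0, w + ((s - D w) / 2) • u)
      = (fderiv ℝ H (0, u) (0, w + ((s - D w) / 2) • u), D (w + ((s - D w) / 2) • u)) :=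
        fderiv_sphericalEquation hdiff _
    _ = (y, s) := by
        rw [hsplit, map_add, map_add, map_smul, map_smul, hw, hradial,
          hH.fderiv_apply_self hdiff hzero, smul_zero, add_zero, smul_eq_mul,
          div_mul_cancel₀ _ two_ne_zero, add_sub_cancel]

theorem closureAtInfinity_affineZeros {H : ℝ × E → Y} {d : ℕ} (hH : IsPosHomogeneous H d) :
    closureAtInfinity (affineZeros H) = closure {q | 0 < q.1 ∧ sphericalEquation H q = 0} := by
  refine congrArg closure (Set.ext fun q => and_congr_right fun hq => ?_)
  rw [hH.smul_snd_mem_affineZeros_iff hq, sphericalEquation_eq_zero_iff, and_comm]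

theorem isConicAtInfinity_affineZeros [FiniteDimensional ℝ E] [FiniteDimensional ℝ Y]
    {H : ℝ × E → Y} {d : ℕ} (hH : IsPosHomogeneous H d) (hsmooth : ContDiff ℝ ω H)
    (hinfinity : ∀ u ≠ 0, H (0, u) = 0 → IsSliceSubmersionAt H (0, u)) :
    IsConicAtInfinity (affineZeros H) := by
  have : ProperSpace E := FiniteDimensional.proper_real E
  refine or_iff_not_imp_left.2 fun hunbounded =>
    ⟨asymptoticSet_nonempty hunbounded, fun u hu => ?_⟩
  have hdiff : Differentiable ℝ H := hsmooth.differentiable (by decide)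
  have heq := contDiff_sphericalEquation hsmooth
  rw [asymptoticSet, mem_ofPred_eq, closureAtInfinity_affineZeros hH] at hu
  have hu₀ : sphericalEquation H (0, u) = 0 :=
    closure_minimal (fun q hq => hq.2) (isClosed_eq heq.continuous continuous_const) hu
  obtain ⟨hzero, hnorm⟩ := sphericalEquation_eq_zero_iff.1 hu₀
  have hne : u ≠ 0 := by
    rintro rfl
    simp at hnorm
  rw [closureAtInfinity_affineZeros hH]
  refine isPSubmanifoldAt_closure heq hu₀
    (isSliceSubmersionAt_sphericalEquation hH (hdiff _) hnorm hzero (hinfinity u hne hzero))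
    fun v hv => ?_
  rw [fderiv_sphericalEquation (hdiff _)] at hv
  exact congrArg Prod.snd hv

end SphericalEquation

section PolynomialFunctions

variable {𝕜 : Type*} [RCLike 𝕜] {n : ℕ}

/-- The polynomial function on `𝕜ⁿ` defined by `p`. -/
noncomputable def polyFun (p : MvPolynomial (Fin n) 𝕜) (x : EuclideanSpace 𝕜 (Fin n)) : 𝕜 :=
  MvPolynomial.eval (fun i => x i) p

theorem polyFun_C (a : 𝕜) : polyFun (MvPolynomial.C a : MvPolynomial (Fin n) 𝕜) = fun _ => a :=
  funext fun _ => MvPolynomial.eval_C a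

theorem polyFun_add (p q : MvPolynomial (Fin n) 𝕜) : polyFun (p + q) = polyFun p + polyFun q :=
  funext fun _ => map_add _ p q

theorem polyFun_mul (p q : MvPolynomial (Fin n) 𝕜) : polyFun (p * q) = polyFun p * polyFun q :=
  funext fun _ => map_mul _ p q

theorem polyFun_X (i : Fin n) : polyFun (MvPolynomial.X i : MvPolynomial (Fin n) 𝕜) =
    (EuclideanSpace.proj i : EuclideanSpace 𝕜 (Fin n) →L[𝕜] 𝕜).restrictScalars ℝ :=
  funext fun _ => MvPolynomial.eval_X i

theorem contDiff_polyFun {m : WithTop ℕ∞} (p : MvPolynomial (Fin n) 𝕜) :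
    ContDiff ℝ m (polyFun p) := by
  have hanalytic : AnalyticOnNhd ℝ (polyFun p) univ :=
    AnalyticOnNhd.eval_continuousLinearMap'
      (fun i => (EuclideanSpace.proj i : EuclideanSpace 𝕜 (Fin n) →L[𝕜] 𝕜).restrictScalars ℝ) p
  exact contDiffOn_univ.1 (hanalytic.contDiffOn uniqueDiffOn_univ)

theorem fderiv_polyFun_apply (p : MvPolynomial (Fin n) 𝕜) (x w : EuclideanSpace 𝕜 (Fin n)) :
    fderiv ℝ (polyFun p) x w = ∑ i, polyFun (MvPolynomial.pderiv i p) x * w i := by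
  have hdiff : ∀ q : MvPolynomial (Fin n) 𝕜, DifferentiableAt ℝ (polyFun q) x := fun q =>
    (contDiff_polyFun q).differentiable one_ne_zero x
  induction p using MvPolynomial.induction_on with
  | C a => simp [polyFun_C, polyFun]
  | add p q hp hq =>
    rw [polyFun_add, fderiv_add (hdiff p) (hdiff q), add_apply, hp, hq]
    simp only [map_add, polyFun_add, Pi.add_apply, add_mul, Finset.sum_add_distrib]
  | mul_X p j hp =>
    have hX : fderiv ℝ (polyFun (MvPolynomial.X j)) x w = w j := by
      rw [polyFun_X, ContinuousLinearMap.fderiv]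
      rfl
    have hpderiv : ∀ i, polyFun (MvPolynomial.pderiv i (p * MvPolynomial.X j)) x =
        polyFun (MvPolynomial.pderiv i p) x * x j + polyFun p x * if j = i then 1 else 0 := by
      intro i
      rw [MvPolynomial.pderiv_mul, MvPolynomial.pderiv_X, Pi.single_apply]
      split_ifs <;> simp [polyFun]
    rw [polyFun_mul, fderiv_mul (hdiff p) (hdiff _)]
    simp only [add_apply, smul_apply, hX, hp, hpderiv]
    have hXx : polyFun (MvPolynomial.X j) x = x j := MvPolynomial.eval_X j
    simp only [hXx, add_mul, Finset.sum_add_distrib, mul_ite, ite_mul, mul_one, mul_zero, zero_mul,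
      Finset.sum_ite_eq, Finset.mem_univ, if_true, smul_eq_mul, Finset.mul_sum]
    rw [add_comm]
    congr 1
    exact Finset.sum_congr rfl fun i _ => by ring

theorem surjective_fderiv_polyFun {p : MvPolynomial (Fin n) 𝕜} {x : EuclideanSpace 𝕜 (Fin n)}
    (hx : x ∉ critLocus p) : Function.Surjective (fderiv ℝ (polyFun p) x) := by
  obtain ⟨j, hj : polyFun (MvPolynomial.pderiv j p) x ≠ 0⟩ := not_forall.1 hx
  intro z
  refine ⟨EuclideanSpace.single j (z / polyFun (MvPolynomial.pderiv j p) x), ?_⟩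
  rw [fderiv_polyFun_apply, Finset.sum_eq_single j]
  · simp [mul_div_cancel₀ _ hj]
  · intro i _ hij
    simp [hij]
  · simp

theorem polyFun_real_smul {p : MvPolynomial (Fin n) 𝕜} {k : ℕ} (hp : p.IsHomogeneous k) (t : ℝ)
    (x : EuclideanSpace 𝕜 (Fin n)) : polyFun p (t • x) = t ^ k • polyFun p x := by
  simp only [polyFun, MvPolynomial.eval_eq', Finset.smul_sum]
  refine Finset.sum_congr rfl fun m hm => ?_
  have hdegree : m.degree = k := by
    by_contra h
    exact MvPolynomial.mem_support_iff.1 hm (hp.coeff_eq_zero h)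
  have hprod : ∏ i, (t • x) i ^ m i = t ^ k • ∏ i, x i ^ m i := by
    simp only [PiLp.smul_apply, smul_pow, Finset.prod_smul, Finset.prod_pow_eq_pow_sum, ← hdegree,
      Finsupp.degree_eq_sum]
  rw [hprod, mul_smul_comm]

end PolynomialFunctions

section Homogenization

variable {𝕜 : Type*} [RCLike 𝕜] {n : ℕ}

/-- The homogenization of `f`, with a real homogenizing variable. -/
noncomputable def homogenization (f : MvPolynomial (Fin n) 𝕜)
    (q : ℝ × EuclideanSpace 𝕜 (Fin n)) : 𝕜 :=
  ∑ k ∈ Finset.range (f.totalDegree + 1),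
    q.1 ^ (f.totalDegree - k) • polyFun (MvPolynomial.homogeneousComponent k f) q.2

theorem contDiff_homogenization {m : WithTop ℕ∞} (f : MvPolynomial (Fin n) 𝕜) :
    ContDiff ℝ m (homogenization f) :=
  ContDiff.sum fun _ _ => (contDiff_fst.pow _).smul ((contDiff_polyFun _).comp contDiff_snd)

theorem isPosHomogeneous_homogenization (f : MvPolynomial (Fin n) 𝕜) :
    IsPosHomogeneous (homogenization f) f.totalDegree := by
  intro t _ q
  simp only [homogenization, Finset.smul_sum]
  refine Finset.sum_congr rfl fun k hk => ?_
  have hle : k ≤ f.totalDegree := Nat.lt_succ_iff.1 (Finset.mem_range.1 hk)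
  rw [Prod.smul_fst, Prod.smul_snd,
    polyFun_real_smul (MvPolynomial.homogeneousComponent_isHomogeneous k f), smul_smul, smul_smul,
    smul_eq_mul, mul_pow, mul_right_comm, pow_sub_mul_pow t hle]

theorem homogenization_one (f : MvPolynomial (Fin n) 𝕜) (x : EuclideanSpace 𝕜 (Fin n)) :
    homogenization f (1, x) = polyFun f x := by
  conv_rhs => rw [← MvPolynomial.sum_homogeneousComponent f]
  simp [homogenization, polyFun]

theorem homogenization_zero (f : MvPolynomial (Fin n) 𝕜) (u : EuclideanSpace 𝕜 (Fin n)) :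
    homogenization f (0, u) = polyFun (leadingForm f) u := by
  rw [homogenization, Finset.sum_range_succ, Finset.sum_eq_zero]
  · simp [leadingForm]
  · intro k hk
    rw [zero_pow (Nat.sub_pos_of_lt (Finset.mem_range.1 hk)).ne', zero_smul]

theorem level_zero_eq_affineZeros (f : MvPolynomial (Fin n) 𝕜) :
    level f 0 = affineZeros (homogenization f) :=
  Set.ext fun x => by rw [affineZeros, mem_ofPred_eq, homogenization_one]; rfl

theorem isSliceSubmersionAt_homogenization {f g : MvPolynomial (Fin n) 𝕜} {s : ℝ}
    {u : EuclideanSpace 𝕜 (Fin n)} (hg : ∀ v, homogenization f (s, v) = polyFun g v)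
    (hu : u ∉ critLocus g) : IsSliceSubmersionAt (homogenization f) (s, u) := by
  rw [isSliceSubmersionAt_iff ((contDiff_homogenization f).differentiable one_ne_zero _),
    funext hg]
  exact surjective_fderiv_polyFun hu

theorem isSliceSubmersionAt_homogenization_zero {f : MvPolynomial (Fin n) 𝕜}
    (hlead : level (leadingForm f) 0 ∩ critLocus (leadingForm f) ⊆ {0})
    {u : EuclideanSpace 𝕜 (Fin n)} (hu : u ≠ 0) (hzero : homogenization f (0, u) = 0) :
    IsSliceSubmersionAt (homogenization f) (0, u) :=
  isSliceSubmersionAt_homogenization (homogenization_zero f) fun hcrit =>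
    hu (hlead ⟨(homogenization_zero f u).symm.trans hzero, hcrit⟩)

theorem isConicAtInfinity_level_zero {f : MvPolynomial (Fin n) 𝕜}
    (hlead : level (leadingForm f) 0 ∩ critLocus (leadingForm f) ⊆ {0}) :
    IsConicAtInfinity (level f 0) := by
  rw [level_zero_eq_affineZeros]
  exact isConicAtInfinity_affineZeros (isPosHomogeneous_homogenization f)
    (contDiff_homogenization f) fun u => isSliceSubmersionAt_homogenization_zero hlead

theorem isLNE_connectedComponentIn_level_zero {f : MvPolynomial (Fin n) 𝕜}
    (hlead : level (leadingForm f) 0 ∩ critLocus (leadingForm f) ⊆ {0})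
    (hreg : Disjoint (level f 0) (critLocus f)) (x : EuclideanSpace 𝕜 (Fin n)) :
    IsLNE (connectedComponentIn (level f 0) x) := by
  rw [level_zero_eq_affineZeros] at hreg ⊢
  exact isLNE_connectedComponentIn_affineZeros (isPosHomogeneous_homogenization f)
    (contDiff_homogenization f) (fun u => isSliceSubmersionAt_homogenization_zero hlead)
    (fun y hy => isSliceSubmersionAt_homogenization (homogenization_one f)
      (disjoint_left.1 hreg hy)) x

end Homogenization

section LeadingForm

variable {𝕜 : Type*} [RCLike 𝕜] {n : ℕ}

theorem homogeneousComponent_totalDegree_add_mul {σ R : Type*} [CommSemiring R]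
    (a b : MvPolynomial σ R) :
    MvPolynomial.homogeneousComponent (a.totalDegree + b.totalDegree) (a * b) =
      MvPolynomial.homogeneousComponent a.totalDegree a *
        MvPolynomial.homogeneousComponent b.totalDegree b := by
  have hexpand : a * b = ∑ i ∈ Finset.range (a.totalDegree + 1),
      ∑ j ∈ Finset.range (b.totalDegree + 1),
        MvPolynomial.homogeneousComponent i a * MvPolynomial.homogeneousComponent j b := by
    rw [← Finset.sum_mul_sum, MvPolynomial.sum_homogeneousComponent,
      MvPolynomial.sum_homogeneousComponent]
  have hcomp : ∀ i j, MvPolynomial.homogeneousComponent (a.totalDegree + b.totalDegree)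
      (MvPolynomial.homogeneousComponent i a * MvPolynomial.homogeneousComponent j b) =
      if a.totalDegree + b.totalDegree = i + j then
        MvPolynomial.homogeneousComponent i a * MvPolynomial.homogeneousComponent j b else 0 :=
    fun i j => MvPolynomial.homogeneousComponent_of_mem <|
      (MvPolynomial.homogeneousComponent_isHomogeneous i a).mul
        (MvPolynomial.homogeneousComponent_isHomogeneous j b)
  conv_lhs => rw [hexpand]
  simp only [map_sum, hcomp]
  rw [Finset.sum_eq_single a.totalDegree, Finset.sum_eq_single b.totalDegree, if_pos rfl]
  · exact fun j _ hj => if_neg (by lia)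
  · simp
  · intro i hi hne
    rw [Finset.mem_range] at hi
    refine Finset.sum_eq_zero fun j hj => if_neg ?_
    rw [Finset.mem_range] at hj
    lia
  · simp

theorem leadingForm_mul {a b : MvPolynomial (Fin n) 𝕜} (ha : a ≠ 0) (hb : b ≠ 0) :
    leadingForm (a * b) = leadingForm a * leadingForm b := by
  rw [leadingForm, MvPolynomial.totalDegree_mul_of_isDomain ha hb,
    homogeneousComponent_totalDegree_add_mul]
  rfl

theorem isUnit_of_isUnit_leadingForm {a : MvPolynomial (Fin n) 𝕜} (h : IsUnit (leadingForm a)) :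
    IsUnit a := by
  have hconst : a.totalDegree = 0 := by
    rw [← (MvPolynomial.homogeneousComponent_isHomogeneous _ a).totalDegree h.ne_zero]
    exact (MvPolynomial.isUnit_iff_totalDegree_of_isReduced.1 h).2
  rwa [leadingForm, hconst, MvPolynomial.homogeneousComponent_zero,
    ← MvPolynomial.totalDegree_eq_zero_iff_eq_C.1 hconst] at h

theorem irreducible_of_irreducible_leadingForm {p : MvPolynomial (Fin n) 𝕜}
    (hp : 0 < p.totalDegree) (h : Irreducible (leadingForm p)) : Irreducible p := by
  refine ⟨fun hunit => hp.ne' (MvPolynomial.isUnit_iff_totalDegree_of_isReduced.1 hunit).2,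
    fun a b hab => ?_⟩
  have hne : a * b ≠ 0 := by
    rintro hzero
    simp [hab, hzero] at hp
  rw [hab, leadingForm_mul (left_ne_zero_of_mul hne) (right_ne_zero_of_mul hne)] at h
  exact (h.isUnit_or_isUnit rfl).imp isUnit_of_isUnit_leadingForm isUnit_of_isUnit_leadingForm

theorem totalDegree_sub_C {f : MvPolynomial (Fin n) 𝕜} (hf : 0 < f.totalDegree) (c : 𝕜) :
    (f - MvPolynomial.C c).totalDegree = f.totalDegree := by
  rw [sub_eq_add_neg, ← MvPolynomial.C_neg]
  exact MvPolynomial.totalDegree_add_eq_left_of_totalDegree_lt (by simpa using hf)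

theorem leadingForm_sub_C {f : MvPolynomial (Fin n) 𝕜} (hf : 0 < f.totalDegree) (c : 𝕜) :
    leadingForm (f - MvPolynomial.C c) = leadingForm f := by
  rw [leadingForm, totalDegree_sub_C hf, map_sub, leadingForm, sub_eq_self]
  exact MvPolynomial.homogeneousComponent_eq_zero _ _ (by simpa using hf)

theorem critLocus_sub_C (f : MvPolynomial (Fin n) 𝕜) (c : 𝕜) :
    critLocus (f - MvPolynomial.C c) = critLocus f := by
  simp only [critLocus, map_sub, MvPolynomial.pderiv_C, sub_zero]

theorem level_sub_C (f : MvPolynomial (Fin n) 𝕜) (c : 𝕜) :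
    level (f - MvPolynomial.C c) 0 = level f c := by
  simp only [level, map_sub, MvPolynomial.eval_C, sub_eq_zero]

end LeadingForm

section Irreducibility

variable {𝕜 : Type*} [RCLike 𝕜] {n : ℕ}

open MvPolynomial in
theorem dvd_of_level_zero_subset [IsAlgClosed 𝕜] {p g : MvPolynomial (Fin n) 𝕜}
    (hp : Irreducible p) (h : level p 0 ⊆ level g 0) : p ∣ g := by
  have hprime : (Ideal.span {p}).IsPrime := (Ideal.span_singleton_prime hp.ne_zero).2 hp.prime
  rw [← Ideal.mem_span_singleton, ← IsPrime.vanishingIdeal_zeroLocus (K := 𝕜) (Ideal.span {p})]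
  intro x hx
  have hpx : WithLp.toLp 2 x ∈ level p 0 := by
    have := hx p (Ideal.mem_span_singleton_self p)
    rwa [aeval_eq_eval] at this
  rw [aeval_eq_eval]
  exact h hpx

theorem level_zero_subset_of_dvd {p g : MvPolynomial (Fin n) 𝕜} (h : p ∣ g) :
    level p 0 ⊆ level g 0 := by
  obtain ⟨k, rfl⟩ := h
  intro x (hx : _ = 0)
  exact (map_mul _ p k).trans (by rw [hx, zero_mul])

theorem isIrreducibleAlgebraicSet_level_zero [IsAlgClosed 𝕜] {p : MvPolynomial (Fin n) 𝕜}
    (hp : Irreducible p) : IsIrreducibleAlgebraicSet (level p 0) := by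
  refine ⟨⟨{p}, by simp [level]⟩, ?_, ?_⟩
  · by_contra hempty
    rw [not_nonempty_iff_eq_empty] at hempty
    exact hp.not_isUnit <| isUnit_of_dvd_one <|
      dvd_of_level_zero_subset hp (hempty ▸ empty_subset _)
  · rintro Z₁ Z₂ ⟨S₁, rfl⟩ ⟨S₂, rfl⟩ hunion
    have hproper : ∀ S : Set (MvPolynomial (Fin n) 𝕜),
        ¬ level p 0 ⊆ {x | ∀ g ∈ S, MvPolynomial.eval (fun i => x i) g = 0} →
        ∃ g ∈ S, ¬ p ∣ g := by
      intro S hS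
      by_contra! hdvd
      exact hS fun x hx g hg => level_zero_subset_of_dvd (hdvd g hg) hx
    by_contra! hne
    obtain ⟨g₁, hg₁, hdvd₁⟩ := hproper S₁ fun h =>
      hne.1 (h.antisymm (hunion ▸ subset_union_left))
    obtain ⟨g₂, hg₂, hdvd₂⟩ := hproper S₂ fun h =>
      hne.2 (h.antisymm (hunion ▸ subset_union_right))
    have hmul : level p 0 ⊆ level (g₁ * g₂) 0 := by
      rw [hunion]
      rintro x (hx | hx)
      · exact level_zero_subset_of_dvd (dvd_mul_right g₁ g₂) (hx g₁ hg₁)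
      · exact level_zero_subset_of_dvd (dvd_mul_left g₂ g₁) (hx g₂ hg₂)
    exact (hp.prime.dvd_or_dvd (dvd_of_level_zero_subset hp hmul)).elim hdvd₁ hdvd₂

end Irreducibility

end ConicLNE

theorem corollary5p3_general {𝕜 : Type*} [RCLike 𝕜] {n : ℕ} (f : MvPolynomial (Fin n) 𝕜)
    (hf : 0 < f.totalDegree) (c : 𝕜) :
    (ConicLNE.level (ConicLNE.leadingForm f) 0 ∩
        ConicLNE.critLocus (ConicLNE.leadingForm f) ⊆ {0} →
      ConicLNE.IsConicAtInfinity (ConicLNE.level f c) ∧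
      (Disjoint (ConicLNE.level f c) (ConicLNE.critLocus f) → ∀ x,
        ConicLNE.IsLNE (connectedComponentIn (ConicLNE.level f c) x))) ∧
    (IsAlgClosed 𝕜 → Irreducible (ConicLNE.leadingForm f) →
      ConicLNE.IsIrreducibleAlgebraicSet (ConicLNE.level f c)) := by
  rw [← ConicLNE.level_sub_C f c, ← ConicLNE.critLocus_sub_C f c, ← ConicLNE.leadingForm_sub_C hf c]
  rw [← ConicLNE.totalDegree_sub_C hf c] at hf
  exact ⟨fun hlead => ⟨ConicLNE.isConicAtInfinity_level_zero hlead,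
      ConicLNE.isLNE_connectedComponentIn_level_zero hlead⟩,
    fun _ hirr => ConicLNE.isIrreducibleAlgebraicSet_level_zero
      (ConicLNE.irreducible_of_irreducible_leadingForm hf hirr)⟩

theorem corollary5p3 (n : ℕ) :
    (∀ (𝕜 : Type) [RCLike 𝕜] (f : MvPolynomial (Fin n) 𝕜), 0 < f.totalDegree →
      ConicLNE.IsGenericForm (ConicLNE.leadingForm f) →
      ∀ c : 𝕜, (ConicLNE.level f c).Nonempty →
        Disjoint (ConicLNE.level f c) (ConicLNE.critLocus f) →
        ConicLNE.IsConicAtInfinity (ConicLNE.level f c) ∧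
        ∀ x ∈ ConicLNE.level f c,
          ConicLNE.IsLNE (connectedComponentIn (ConicLNE.level f c) x)) ∧
    (∀ f : MvPolynomial (Fin n) ℂ, 0 < f.totalDegree →
      ConicLNE.IsGenericForm (ConicLNE.leadingForm f) →
      ∀ c : ℂ, ConicLNE.IsIrreducibleAlgebraicSet (ConicLNE.level f c)) :=
  ⟨fun _ _ f hf hgen c _ hreg =>
    ((corollary5p3_general f hf c).1 hgen.2).imp_right fun hlne x _ => hlne hreg x,
  fun f hf hgen c => (corollary5p3_general f hf c).2 inferInstance hgen.1⟩
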